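/- Let $\Omega\subset\mathbb{R}^d$ be a bounded Lipschitz domain, $s\in(0,1)$ with $s\neq\frac12$, and $\alpha,\beta>0$. Let $W$ be one of the following three real Hilbert spaces, which consist of the same functions on $\Omega$ and have equivalent norms: (a) $W=H_0^s(\Omega)$, the closure of $C_c^\infty(\Omega)$ in $H^s(\Omega)$, with the inner product of $H^s(\Omega)$, where for $U\subseteq\mathbb{R}^d$ open $$(u,w)_{H^s(U)}=\int_U uw\,dx+\frac{c_{d,s}}{2}\int_U\int_U\frac{(u(x)-u(y))(w(x)-w(y))}{|x-y|^{d+2s}}\,dy\,dx,\qquad c_{d,s}=\frac{s2^{2s}\Gamma(s+\frac d2)}{\pi^{d/2}\Gamma(1-s)},$$ and $H^s(U)$ is the space of all $w\in L^2(U)$ with $\frac{|w(x)-w(y)|}{|x-y|^{d/2+s}}\in L^2(U\times U)$; (b) $W=\tilde H^s(\Omega)=\{w\in H^s(\mathbb{R}^d): w=0 \text{ a.e. in } \mathbb{R}^d\setminus\Omega\}$, with the inner product of $H^s(\mathbb{R}^d)$; (c) $W=\mathbb{H}^s(\Omega)=\{w=\sum_n w_n\phi_n\in L^2(\Omega): \sum_n\lambda_n^s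 w_n^2<\infty\}$, $w_n=\int_\Omega w\phi_n\,dx$, with the inner product $\sum_n\lambda_n^s u_nw_n$, where $(\phi_n)$ is an $L^2(\Omega)$-orthonormal basis of eigenfunctions of the Laplacian with zero Dirichlet boundary conditions, with eigenvalues $\lambda_n$. Let $F\colon W\to\mathbb{R}$ be weakly lower semicontinuous, continuously Fréchet differentiable, and bounded from below by an affine function, i.e. there are $g\in W^*$ and $c\in\mathbb{R}$ with $F(w)\ge g(w)+c$ for all $w\in W$. Let $\bar w_0\in W$ be a local solution (a local minimizer with respect to the norm of $W$) of $$\min_{w\in W}\ F(w)+\frac{\alpha}{2}\|w\|_W^2+\beta\,|\{x\in\Omega: w(x)\neq0\}|,$$ where $|\cdot|$ is Lebesgue measure. Then there is exactly one $\bar\lambda_0\in W^*$ with $$\alpha(\bar w_0,v)_W+\beta\langle\bar\lambda_0,v\rangle_W=-\langle F'(\bar w_0),v\rangle_W\qquad\forall v\in W,$$ and it satisfies $$\langle\bar\lambda_0,\bar w_0\rangle_W=0.$$ -/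

import Mathlib

open MeasureTheory Filter Topology
open scoped ContDiff NNReal

noncomputable section

namespace FracSparse

/-- Euclidean space `ℝ^d`. -/
abbrev E (d : ℕ) : Type := EuclideanSpace ℝ (Fin d)

/-- `L²(U)` for `U ⊆ ℝ^d`, with Lebesgue measure. -/
abbrev L2 {d : ℕ} (U : Set (E d)) : Type := Lp ℝ 2 (volume.restrict U)

/-- `Ω` is a bounded Lipschitz domain: bounded, open, connected, and near every boundary point `Ω`
is, in suitable orthonormal coordinates, the strict epigraph of a Lipschitz function. The unit
vector `e` is the direction of the last coordinate, the hyperplane `e^⊥` carries the others. -/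
structure IsBoundedLipschitzDomain {d : ℕ} (Ω : Set (E d)) : Prop where
  isOpen : IsOpen Ω
  isConnected : IsConnected Ω
  isBounded : Bornology.IsBounded Ω
  lipschitz_boundary : ∀ x ∈ frontier Ω, ∃ e : E d, ‖e‖ = 1 ∧
    ∃ (K : ℝ≥0) (g : (Submodule.span ℝ {e})ᗮ → ℝ), LipschitzWith K g ∧
      ∃ r : ℝ, 0 < r ∧ ∀ y ∈ Metric.ball x r,
        (y ∈ Ω ↔ g ((Submodule.span ℝ {e})ᗮ.orthogonalProjectionOnto y) < inner ℝ e y)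

/-- `f ∈ C_c^∞(Ω)`. -/
structure IsTestFunction {d : ℕ} (Ω : Set (E d)) (f : E d → ℝ) : Prop where
  smooth : ContDiff ℝ ∞ f
  compact : HasCompactSupport f
  support : tsupport f ⊆ Ω

theorem IsTestFunction.zero {d : ℕ} (Ω : Set (E d)) : IsTestFunction Ω (0 : E d → ℝ) where
  smooth := contDiff_const
  compact := HasCompactSupport.zero
  support := by simp [tsupport]

theorem IsTestFunction.add {d : ℕ} {Ω : Set (E d)} {f g : E d → ℝ}
    (hf : IsTestFunction Ω f) (hg : IsTestFunction Ω g) : IsTestFunction Ω (f + g) where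
  smooth := hf.smooth.add hg.smooth
  compact := hf.compact.add hg.compact
  support := (tsupport_add f g).trans (Set.union_subset hf.support hg.support)

theorem IsTestFunction.smul {d : ℕ} {Ω : Set (E d)} {f : E d → ℝ}
    (hf : IsTestFunction Ω f) (c : ℝ) : IsTestFunction Ω (c • f) where
  smooth := hf.smooth.const_smul c
  compact := hf.compact.smul_left (f := fun _ => c)
  support := (tsupport_smul_subset_right (fun _ => c) f).trans hf.support

/-! ### The spaces `H^s(U)`, `H_0^s(Ω)` and `H̃^s(Ω)` -/

/-- The constant `c_{d,s} = s 2^{2s} Γ(s + d/2) / (π^{d/2} Γ(1 - s))`. -/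
def cConst (d : ℕ) (s : ℝ) : ℝ :=
  s * 2 ^ (2 * s) * Real.Gamma (s + d / 2) / (Real.pi ^ ((d : ℝ) / 2) * Real.Gamma (1 - s))

theorem cConst_nonneg (d : ℕ) (s : Set.Ioo (0 : ℝ) 1) : 0 ≤ cConst d s := by
  obtain ⟨s, h0, h1⟩ := s
  have g1 : 0 < Real.Gamma (s + d / 2) := Real.Gamma_pos_of_pos (by positivity)
  have g2 : 0 < Real.Gamma (1 - s) := Real.Gamma_pos_of_pos (by linarith)
  unfold cConst
  positivity

/-- The difference quotient `(w(x) - w(y)) / |x - y|^{d/2 + s}` as a function of `(x, y)`. -/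
def diffQuot {d : ℕ} (s : ℝ) (w : E d → ℝ) (p : E d × E d) : ℝ :=
  (w p.1 - w p.2) / ‖p.1 - p.2‖ ^ ((d : ℝ) / 2 + s)

/-- Lebesgue measure on `U × U`. -/
abbrev vol2 {d : ℕ} (U : Set (E d)) : Measure (E d × E d) :=
  (volume.restrict U).prod (volume.restrict U)

theorem diffQuot_congr {d : ℕ} {U : Set (E d)} (s : ℝ) {v w : E d → ℝ}
    (h : v =ᵐ[volume.restrict U] w) : diffQuot s v =ᵐ[vol2 U] diffQuot s w := by
  filter_upwards [Measure.quasiMeasurePreserving_fst.ae_eq_comp h,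
    Measure.quasiMeasurePreserving_snd.ae_eq_comp h] with p h1 h2
  simp only [Function.comp_apply] at h1 h2
  simp only [diffQuot, h1, h2]

theorem diffQuot_add {d : ℕ} (s : ℝ) (v w : E d → ℝ) :
    diffQuot s (v + w) = diffQuot s v + diffQuot s w := by
  funext p
  simp only [diffQuot, Pi.add_apply]
  ring

theorem diffQuot_smul {d : ℕ} (s c : ℝ) (w : E d → ℝ) :
    diffQuot s (c • w) = c • diffQuot s w := by
  funext p
  simp only [diffQuot, Pi.smul_apply, smul_eq_mul]
  ring

theorem diffQuot_coe_add {d : ℕ} {U : Set (E d)} (s : ℝ) (v w : L2 U) :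
    diffQuot s ⇑(v + w) =ᵐ[vol2 U] diffQuot s v + diffQuot s w := by
  rw [← diffQuot_add]
  exact diffQuot_congr s (Lp.coeFn_add v w)

theorem diffQuot_coe_smul {d : ℕ} {U : Set (E d)} (s c : ℝ) (w : L2 U) :
    diffQuot s ⇑(c • w) =ᵐ[vol2 U] c • diffQuot s w := by
  rw [← diffQuot_smul]
  exact diffQuot_congr s (Lp.coeFn_smul c w)

/-- The functions `w ∈ L²(U)` whose difference quotient is in `L²(U × U)`. -/
def hsSubmodule {d : ℕ} (U : Set (E d)) (s : Set.Ioo (0 : ℝ) 1) : Submodule ℝ (L2 U) where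
  carrier := {w | MemLp (diffQuot s w) 2 (vol2 U)}
  zero_mem' := by
    have h : diffQuot (d := d) s ⇑(0 : L2 U) =ᵐ[vol2 U] (0 : E d × E d → ℝ) := by
      refine (diffQuot_congr s (Lp.coeFn_zero ℝ 2 (volume.restrict U))).trans ?_
      exact Eventually.of_forall fun p => by simp [diffQuot]
    exact (memLp_congr_ae h).2 MemLp.zero
  add_mem' := fun {v w} hv hw => (memLp_congr_ae (diffQuot_coe_add s v w)).2 (hv.add hw)
  smul_mem' := fun c w hw => (memLp_congr_ae (diffQuot_coe_smul s c w)).2 (hw.const_smul c)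

/-- The fractional Sobolev space `H^s(U)`. It is a type of its own, because it carries the norm
below and not the norm of `L²(U)`. -/
def Hs {d : ℕ} (U : Set (E d)) (s : Set.Ioo (0 : ℝ) 1) : Type := hsSubmodule U s

instance {d : ℕ} (U : Set (E d)) (s : Set.Ioo (0 : ℝ) 1) : AddCommGroup (Hs U s) :=
  inferInstanceAs (AddCommGroup (hsSubmodule U s))

instance {d : ℕ} (U : Set (E d)) (s : Set.Ioo (0 : ℝ) 1) : Module ℝ (Hs U s) :=
  inferInstanceAs (Module ℝ (hsSubmodule U s))

/-- The inclusion `H^s(U) → L²(U)`. -/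
def Hs.toL2 {d : ℕ} {U : Set (E d)} {s : Set.Ioo (0 : ℝ) 1} : Hs U s →ₗ[ℝ] L2 U :=
  (hsSubmodule U s).subtype

theorem Hs.toL2_add {d : ℕ} {U : Set (E d)} {s : Set.Ioo (0 : ℝ) 1} (u v : Hs U s) :
    (u + v).toL2 = u.toL2 + v.toL2 := rfl

theorem Hs.toL2_smul {d : ℕ} {U : Set (E d)} {s : Set.Ioo (0 : ℝ) 1} (r : ℝ) (u : Hs U s) :
    (r • u).toL2 = r • u.toL2 := rfl

theorem Hs.memLp_diffQuot {d : ℕ} {U : Set (E d)} {s : Set.Ioo (0 : ℝ) 1} (w : Hs U s) :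
    MemLp (diffQuot s w.toL2) 2 (vol2 U) := Subtype.property w

/-- The inner product of `H^s(U)`:
`∫_U u w dx + (c_{d,s}/2) ∫_U ∫_U (u(x)-u(y)) (w(x)-w(y)) / |x-y|^{d+2s} dy dx`. -/
def Hs.innerProd {d : ℕ} {U : Set (E d)} {s : Set.Ioo (0 : ℝ) 1} (u w : Hs U s) : ℝ :=
  (∫ x in U, u.toL2 x * w.toL2 x) +
    cConst d s / 2 * ∫ p, diffQuot s u.toL2 p * diffQuot s w.toL2 p ∂(vol2 U)

theorem Hs.innerProd_eq {d : ℕ} {U : Set (E d)} {s : Set.Ioo (0 : ℝ) 1} (u w : Hs U s) :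
    u.innerProd w = inner ℝ u.toL2 w.toL2 +
      cConst d s / 2 * ∫ p, diffQuot s u.toL2 p * diffQuot s w.toL2 p ∂(vol2 U) := by
  rw [Hs.innerProd, L2.inner_def]
  simp [mul_comm]

theorem Hs.integral_nonneg {d : ℕ} {U : Set (E d)} {s : Set.Ioo (0 : ℝ) 1} (u : Hs U s) :
    0 ≤ ∫ p, diffQuot s u.toL2 p * diffQuot s u.toL2 p ∂(vol2 U) :=
  MeasureTheory.integral_nonneg fun _ => mul_self_nonneg _

theorem Hs.integrable_mul {d : ℕ} {U : Set (E d)} {s : Set.Ioo (0 : ℝ) 1} (u w : Hs U s) :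
    Integrable (fun p => diffQuot s u.toL2 p * diffQuot s w.toL2 p) (vol2 U) :=
  MemLp.integrable_mul (p := 2) (q := 2) u.memLp_diffQuot w.memLp_diffQuot

theorem Hs.integral_add {d : ℕ} {U : Set (E d)} {s : Set.Ioo (0 : ℝ) 1} (u v w : Hs U s) :
    ∫ p, diffQuot s (Hs.toL2 u + Hs.toL2 v) p * diffQuot s w.toL2 p ∂(vol2 U) =
      (∫ p, diffQuot s u.toL2 p * diffQuot s w.toL2 p ∂(vol2 U)) +
        ∫ p, diffQuot s v.toL2 p * diffQuot s w.toL2 p ∂(vol2 U) := by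
  rw [← MeasureTheory.integral_add (u.integrable_mul w) (v.integrable_mul w)]
  refine integral_congr_ae ?_
  filter_upwards [diffQuot_coe_add s u.toL2 v.toL2] with p hp
  rw [hp, Pi.add_apply, add_mul]

theorem Hs.integral_smul {d : ℕ} {U : Set (E d)} {s : Set.Ioo (0 : ℝ) 1} (r : ℝ)
    (u w : Hs U s) :
    ∫ p, diffQuot s (r • Hs.toL2 u) p * diffQuot s w.toL2 p ∂(vol2 U) =
      r * ∫ p, diffQuot s u.toL2 p * diffQuot s w.toL2 p ∂(vol2 U) := by
  rw [← integral_const_mul]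
  refine integral_congr_ae ?_
  filter_upwards [diffQuot_coe_smul s r u.toL2] with p hp
  rw [hp, Pi.smul_apply, smul_eq_mul, mul_assoc]

theorem Hs.innerProd_add_left {d : ℕ} {U : Set (E d)} {s : Set.Ioo (0 : ℝ) 1} (u v w : Hs U s) :
    (u + v).innerProd w = u.innerProd w + v.innerProd w := by
  rw [Hs.innerProd_eq, Hs.innerProd_eq, Hs.innerProd_eq, Hs.toL2_add, Hs.integral_add,
    inner_add_left]
  ring

theorem Hs.innerProd_smul_left {d : ℕ} {U : Set (E d)} {s : Set.Ioo (0 : ℝ) 1} (r : ℝ)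
    (u w : Hs U s) : (r • u).innerProd w = r * u.innerProd w := by
  rw [Hs.innerProd_eq, Hs.innerProd_eq, Hs.toL2_smul, Hs.integral_smul,
    real_inner_smul_left u.toL2 w.toL2 r]
  ring

theorem Hs.le_innerProd_self {d : ℕ} {U : Set (E d)} {s : Set.Ioo (0 : ℝ) 1} (u : Hs U s) :
    inner ℝ u.toL2 u.toL2 ≤ u.innerProd u := by
  rw [Hs.innerProd_eq]
  exact le_add_of_nonneg_right
    (mul_nonneg (div_nonneg (cConst_nonneg d s) zero_le_two) u.integral_nonneg)

theorem Hs.innerProd_definite {d : ℕ} {U : Set (E d)} {s : Set.Ioo (0 : ℝ) 1} (u : Hs U s)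
    (hu : u.innerProd u = 0) : u = 0 := by
  have h : inner ℝ u.toL2 u.toL2 = 0 :=
    le_antisymm (hu ▸ u.le_innerProd_self) real_inner_self_nonneg
  have h2 : u.toL2 = 0 := inner_self_eq_zero.1 h
  exact Subtype.ext h2

/-- `Hs.innerProd` is an inner product. -/
@[reducible]
def Hs.core {d : ℕ} (U : Set (E d)) (s : Set.Ioo (0 : ℝ) 1) :
    InnerProductSpace.Core ℝ (Hs U s) where
  inner u w := u.innerProd w
  conj_inner_symm u w := by simp [Hs.innerProd, mul_comm]
  re_inner_nonneg u := le_trans real_inner_self_nonneg u.le_innerProd_self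
  add_left := Hs.innerProd_add_left
  smul_left u w r := Hs.innerProd_smul_left r u w
  definite := Hs.innerProd_definite

instance {d : ℕ} (U : Set (E d)) (s : Set.Ioo (0 : ℝ) 1) : NormedAddCommGroup (Hs U s) :=
  (Hs.core U s).toNormedAddCommGroup

instance {d : ℕ} (U : Set (E d)) (s : Set.Ioo (0 : ℝ) 1) : InnerProductSpace ℝ (Hs U s) :=
  InnerProductSpace.ofCore (Hs.core U s).toCore

/-- `C_c^∞(Ω)` as a subspace of `H^s(Ω)`. -/
def testHs {d : ℕ} (Ω : Set (E d)) (s : Set.Ioo (0 : ℝ) 1) : Submodule ℝ (Hs Ω s) where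
  carrier := {w | ∃ f, IsTestFunction Ω f ∧ w.toL2 =ᵐ[volume.restrict Ω] f}
  zero_mem' := ⟨0, IsTestFunction.zero Ω, by rw [map_zero]; exact Lp.coeFn_zero _ _ _⟩
  add_mem' := by
    rintro v w ⟨f, hf, hvf⟩ ⟨g, hg, hwg⟩
    refine ⟨f + g, hf.add hg, ?_⟩
    rw [map_add]
    exact (Lp.coeFn_add _ _).trans (hvf.add hwg)
  smul_mem' := by
    rintro c w ⟨f, hf, hwf⟩
    refine ⟨c • f, hf.smul c, ?_⟩
    rw [map_smul]
    exact (Lp.coeFn_smul _ _).trans (hwf.const_smul c)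

/-- `H_0^s(Ω)`, the closure of `C_c^∞(Ω)` in `H^s(Ω)`, with the inner product of `H^s(Ω)`. -/
abbrev H0s {d : ℕ} (Ω : Set (E d)) (s : Set.Ioo (0 : ℝ) 1) : Submodule ℝ (Hs Ω s) :=
  (testHs Ω s).topologicalClosure

/-- `H̃^s(Ω)`, the functions in `H^s(ℝ^d)` that vanish almost everywhere outside `Ω`, with the
inner product of `H^s(ℝ^d)`. -/
def tildeHs {d : ℕ} (Ω : Set (E d)) (s : Set.Ioo (0 : ℝ) 1) :
    Submodule ℝ (Hs (Set.univ : Set (E d)) s) where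
  carrier := {w | ∀ᵐ x ∂(volume : Measure (E d)), x ∉ Ω → w.toL2 x = 0}
  zero_mem' := by
    have h : ⇑(0 : L2 (Set.univ : Set (E d))) =ᵐ[volume.restrict Set.univ] 0 :=
      Lp.coeFn_zero ℝ 2 (volume.restrict (Set.univ : Set (E d)))
    rw [Filter.EventuallyEq, congrArg ae Measure.restrict_univ] at h
    simp only [Set.mem_ofPred_eq, map_zero]
    filter_upwards [h] with x hx _
    exact hx
  add_mem' := by
    intro v w hv hw
    have h := Lp.coeFn_add v.toL2 w.toL2
    simp only [Measure.restrict_univ] at h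
    simp only [Set.mem_ofPred_eq, map_add] at hv hw ⊢
    filter_upwards [h, hv, hw] with x hx h1 h2 hxΩ
    rw [hx, Pi.add_apply, h1 hxΩ, h2 hxΩ, add_zero]
  smul_mem' := by
    intro c w hw
    have h := Lp.coeFn_smul c w.toL2
    simp only [Measure.restrict_univ] at h
    simp only [Set.mem_ofPred_eq, map_smul] at hw ⊢
    filter_upwards [h, hw] with x hx h1 hxΩ
    rw [hx, Pi.smul_apply, h1 hxΩ, smul_zero]

/-! ### The Dirichlet Laplacian and the spectral space `ℍ^s(Ω)` -/

theorem gradient_test_add {d : ℕ} {Ω : Set (E d)} {f g : E d → ℝ}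
    (hf : IsTestFunction Ω f) (hg : IsTestFunction Ω g) :
    gradient (f + g) = gradient f + gradient g := by
  funext x
  have h1 : DifferentiableAt ℝ f x := hf.smooth.differentiable (by simp) x
  have h2 : DifferentiableAt ℝ g x := hg.smooth.differentiable (by simp) x
  simp only [gradient, Pi.add_apply, fderiv_add h1 h2, map_add]

theorem gradient_test_smul {d : ℕ} {Ω : Set (E d)} {f : E d → ℝ}
    (hf : IsTestFunction Ω f) (c : ℝ) : gradient (c • f) = c • gradient f := by
  funext x
  have h1 : DifferentiableAt ℝ f x := hf.smooth.differentiable (by simp) x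
  simp only [gradient, Pi.smul_apply, fderiv_const_smul h1, map_smulₛₗ, conj_trivial]

/-- The pairs `(φ, ∇φ)` with `φ ∈ C_c^∞(Ω)`, in `L²(Ω) × L²(Ω; ℝ^d)`. -/
def testGraph {d : ℕ} (Ω : Set (E d)) :
    Submodule ℝ (L2 Ω × Lp (E d) 2 (volume.restrict Ω)) where
  carrier := {p | ∃ f, IsTestFunction Ω f ∧ p.1 =ᵐ[volume.restrict Ω] f ∧
    p.2 =ᵐ[volume.restrict Ω] gradient f}
  zero_mem' := by
    refine ⟨0, IsTestFunction.zero Ω, Lp.coeFn_zero _ _ _, ?_⟩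
    have h : gradient (0 : E d → ℝ) = 0 := by
      funext x
      simp [gradient]
    rw [h]
    exact Lp.coeFn_zero _ _ _
  add_mem' := by
    rintro p q ⟨f, hf, h1, h2⟩ ⟨g, hg, h3, h4⟩
    refine ⟨f + g, hf.add hg, (Lp.coeFn_add _ _).trans (h1.add h3), ?_⟩
    rw [gradient_test_add hf hg]
    exact (Lp.coeFn_add _ _).trans (h2.add h4)
  smul_mem' := by
    rintro c p ⟨f, hf, h1, h2⟩
    refine ⟨c • f, hf.smul c, (Lp.coeFn_smul _ _).trans (h1.const_smul c), ?_⟩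
    rw [gradient_test_smul hf c]
    exact (Lp.coeFn_smul _ _).trans (h2.const_smul c)

/-- The pairs `(u, ∇u)` with `u ∈ H_0^1(Ω)`, the closure of `C_c^∞(Ω)` in the `H^1`-norm. -/
def h01Graph {d : ℕ} (Ω : Set (E d)) : Submodule ℝ (L2 Ω × Lp (E d) 2 (volume.restrict Ω)) :=
  (testGraph Ω).topologicalClosure

/-- The eigenspace of the Dirichlet Laplacian on `Ω` for the value `μ`: the `u ∈ H_0^1(Ω)` with
`∫_Ω ∇u · ∇v dx = μ ∫_Ω u v dx` for all `v ∈ H_0^1(Ω)`. -/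
def eigenspace {d : ℕ} (Ω : Set (E d)) (μ : ℝ) : Submodule ℝ (L2 Ω) where
  carrier := {u | ∃ g, (u, g) ∈ h01Graph Ω ∧
    ∀ v h, (v, h) ∈ h01Graph Ω → inner ℝ g h = μ * inner ℝ u v}
  zero_mem' := ⟨0, (h01Graph Ω).zero_mem, fun v h _ => by simp⟩
  add_mem' := by
    rintro u₁ u₂ ⟨g₁, h₁, e₁⟩ ⟨g₂, h₂, e₂⟩
    refine ⟨g₁ + g₂, (h01Graph Ω).add_mem h₁ h₂, fun v h hv => ?_⟩
    rw [inner_add_left, inner_add_left, e₁ v h hv, e₂ v h hv, mul_add]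
  smul_mem' := by
    rintro c u ⟨g, h, e⟩
    refine ⟨c • g, (h01Graph Ω).smul_mem c h, fun v k hv => ?_⟩
    rw [real_inner_smul_left, real_inner_smul_left, e v k hv]
    ring

/-- The orthogonal projection of `L²(Ω)` onto the eigenspace for `μ`: it maps `w` to the sum of
`(∫_Ω w φ_n dx) φ_n` over the members `φ_n` with eigenvalue `μ` of an orthonormal system of
eigenfunctions (it is zero if `μ` is not an eigenvalue). Eigenspaces are closed; the closure only
serves to have the projection at hand without a proof of that. -/
def eigenProj {d : ℕ} (Ω : Set (E d)) (μ : ℝ) : L2 Ω →L[ℝ] L2 Ω :=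
  (eigenspace Ω μ).topologicalClosure.starProjection

/-- The functions `w ∈ L²(Ω)` that equal their expansion in Dirichlet eigenfunctions and satisfy
`∑ λ_n^s w_n² < ∞`, with `w_n = ∫_Ω w φ_n dx`. The sum is arranged by eigenvalues: the terms with
`λ_n = μ` add up to `μ^s ‖P_μ w‖²`. All Dirichlet eigenvalues are positive. -/
def spectralSubmodule {d : ℕ} (Ω : Set (E d)) (s : Set.Ioo (0 : ℝ) 1) : Submodule ℝ (L2 Ω) where
  carrier := {w | HasSum (fun μ : Set.Ioi (0 : ℝ) => eigenProj Ω μ w) w ∧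
    Summable fun μ : Set.Ioi (0 : ℝ) => (μ : ℝ) ^ (s : ℝ) * ‖eigenProj Ω μ w‖ ^ 2}
  zero_mem' := by simp [hasSum_zero, summable_zero]
  add_mem' := by
    rintro v w ⟨hv, hv'⟩ ⟨hw, hw'⟩
    refine ⟨by simpa only [map_add] using hv.add hw, ?_⟩
    refine Summable.of_nonneg_of_le (fun μ => ?_) (fun μ => ?_) ((hv'.add hw').mul_left 2)
    · exact mul_nonneg (Real.rpow_nonneg (le_of_lt μ.2) _) (sq_nonneg _)
    · have h0 : (0 : ℝ) ≤ (μ : ℝ) ^ (s : ℝ) := Real.rpow_nonneg (le_of_lt μ.2) _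
      have h1 := norm_add_le (eigenProj Ω μ v) (eigenProj Ω μ w)
      have h2 : ‖eigenProj Ω μ v + eigenProj Ω μ w‖ ^ 2 ≤
          2 * (‖eigenProj Ω μ v‖ ^ 2 + ‖eigenProj Ω μ w‖ ^ 2) := by
        nlinarith [norm_nonneg (eigenProj Ω μ v + eigenProj Ω μ w),
          sq_nonneg (‖eigenProj Ω μ v‖ - ‖eigenProj Ω μ w‖)]
      rw [map_add]
      nlinarith [mul_le_mul_of_nonneg_left h2 h0]
  smul_mem' := by
    rintro c w ⟨hw, hw'⟩
    refine ⟨by simpa only [map_smul] using hw.const_smul c, ?_⟩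
    refine (hw'.mul_left (c ^ 2)).congr fun μ => ?_
    rw [map_smul, norm_smul, mul_pow, Real.norm_eq_abs, sq_abs]
    ring

/-- The spectral fractional Sobolev space `ℍ^s(Ω)`; a type of its own, because it carries the norm
below and not the norm of `L²(Ω)`. -/
def SpectralHs {d : ℕ} (Ω : Set (E d)) (s : Set.Ioo (0 : ℝ) 1) : Type := spectralSubmodule Ω s

instance {d : ℕ} (Ω : Set (E d)) (s : Set.Ioo (0 : ℝ) 1) : AddCommGroup (SpectralHs Ω s) :=
  inferInstanceAs (AddCommGroup (spectralSubmodule Ω s))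

instance {d : ℕ} (Ω : Set (E d)) (s : Set.Ioo (0 : ℝ) 1) : Module ℝ (SpectralHs Ω s) :=
  inferInstanceAs (Module ℝ (spectralSubmodule Ω s))

/-- The inclusion `ℍ^s(Ω) → L²(Ω)`. -/
def SpectralHs.toL2 {d : ℕ} {Ω : Set (E d)} {s : Set.Ioo (0 : ℝ) 1} :
    SpectralHs Ω s →ₗ[ℝ] L2 Ω :=
  (spectralSubmodule Ω s).subtype

/-- The inner product `∑ λ_n^s u_n w_n` of `ℍ^s(Ω)`, arranged by eigenvalues. -/
def SpectralHs.innerProd {d : ℕ} {Ω : Set (E d)} {s : Set.Ioo (0 : ℝ) 1}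
    (u w : SpectralHs Ω s) : ℝ :=
  ∑' μ : Set.Ioi (0 : ℝ),
    (μ : ℝ) ^ (s : ℝ) * inner ℝ (eigenProj Ω μ u.toL2) (eigenProj Ω μ w.toL2)

theorem SpectralHs.hasSum {d : ℕ} {Ω : Set (E d)} {s : Set.Ioo (0 : ℝ) 1}
    (w : SpectralHs Ω s) :
    HasSum (fun μ : Set.Ioi (0 : ℝ) => eigenProj Ω μ w.toL2) w.toL2 := (Subtype.property w).1

theorem SpectralHs.summable_sq {d : ℕ} {Ω : Set (E d)} {s : Set.Ioo (0 : ℝ) 1}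
    (w : SpectralHs Ω s) :
    Summable fun μ : Set.Ioi (0 : ℝ) => (μ : ℝ) ^ (s : ℝ) * ‖eigenProj Ω μ w.toL2‖ ^ 2 :=
  (Subtype.property w).2

theorem SpectralHs.summable_inner {d : ℕ} {Ω : Set (E d)} {s : Set.Ioo (0 : ℝ) 1}
    (u w : SpectralHs Ω s) : Summable fun μ : Set.Ioi (0 : ℝ) =>
      (μ : ℝ) ^ (s : ℝ) * inner ℝ (eigenProj Ω μ u.toL2) (eigenProj Ω μ w.toL2) := by
  refine Summable.of_norm_bounded (u.summable_sq.add w.summable_sq) fun μ => ?_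
  have h0 : (0 : ℝ) ≤ (μ : ℝ) ^ (s : ℝ) := Real.rpow_nonneg (le_of_lt μ.2) _
  have h1 := abs_real_inner_le_norm (eigenProj Ω μ u.toL2) (eigenProj Ω μ w.toL2)
  rw [Real.norm_eq_abs, abs_mul, abs_of_nonneg h0, ← mul_add]
  refine mul_le_mul_of_nonneg_left (h1.trans ?_) h0
  nlinarith [sq_nonneg (‖eigenProj Ω μ u.toL2‖ - ‖eigenProj Ω μ w.toL2‖),
    sq_nonneg ‖eigenProj Ω μ u.toL2‖, sq_nonneg ‖eigenProj Ω μ w.toL2‖]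

/-- `SpectralHs.innerProd` is an inner product. -/
@[reducible]
def SpectralHs.core {d : ℕ} (Ω : Set (E d)) (s : Set.Ioo (0 : ℝ) 1) :
    InnerProductSpace.Core ℝ (SpectralHs Ω s) where
  inner u w := u.innerProd w
  conj_inner_symm u w := by simp [SpectralHs.innerProd, real_inner_comm]
  re_inner_nonneg u := by
    refine tsum_nonneg fun μ => mul_nonneg (Real.rpow_nonneg (le_of_lt μ.2) _) real_inner_self_nonneg
  add_left u v w := by
    rw [SpectralHs.innerProd, SpectralHs.innerProd, SpectralHs.innerProd,
      ← (u.summable_inner w).tsum_add (v.summable_inner w)]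
    simp only [map_add, inner_add_left, mul_add]
  smul_left u w r := by
    simp only [SpectralHs.innerProd, map_smul, real_inner_smul_left, conj_trivial,
      ← tsum_mul_left]
    exact tsum_congr fun μ => by ring
  definite u hu := by
    have hnn : ∀ μ : Set.Ioi (0 : ℝ), 0 ≤ (μ : ℝ) ^ (s : ℝ) *
        inner ℝ (eigenProj Ω μ u.toL2) (eigenProj Ω μ u.toL2) := fun μ =>
      mul_nonneg (Real.rpow_nonneg (le_of_lt μ.2) _) real_inner_self_nonneg
    have h0 := (hasSum_zero_iff_of_nonneg hnn).1 (by
      have := (u.summable_inner u).hasSum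
      rwa [show ∑' μ : Set.Ioi (0 : ℝ), (μ : ℝ) ^ (s : ℝ) *
        inner ℝ (eigenProj Ω μ u.toL2) (eigenProj Ω μ u.toL2) = 0 from hu] at this)
    have h1 : ∀ μ : Set.Ioi (0 : ℝ), eigenProj Ω μ u.toL2 = 0 := fun μ => by
      have h2 := congrFun h0 μ
      rcases mul_eq_zero.1 h2 with h3 | h3
      · exact absurd h3 (Real.rpow_pos_of_pos μ.2 _).ne'
      · exact inner_self_eq_zero.1 h3
    have h2 := u.hasSum
    simp only [h1] at h2
    exact Subtype.ext (h2.unique hasSum_zero)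

instance {d : ℕ} (Ω : Set (E d)) (s : Set.Ioo (0 : ℝ) 1) :
    NormedAddCommGroup (SpectralHs Ω s) :=
  (SpectralHs.core Ω s).toNormedAddCommGroup

instance {d : ℕ} (Ω : Set (E d)) (s : Set.Ioo (0 : ℝ) 1) :
    InnerProductSpace ℝ (SpectralHs Ω s) :=
  InnerProductSpace.ofCore (SpectralHs.core Ω s).toCore

/-! ### The space `W` and the optimization problem -/

/-- The three choices of the inner product on `W`. -/
inductive Variant
  | restricted
  | extended
  | spectral

/-- The space `W`: for `s ∈ (0,1)`, `s ≠ 1/2`, the spaces `H_0^s(Ω)`, `H̃^s(Ω)` and `ℍ^s(Ω)` have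
the same elements (up to extension by zero) and equivalent norms, but different inner products.
For `s < 1/2` the space `H^s(Ω)` coincides with `H_0^s(Ω)` as well, with the same inner product. -/
def W {d : ℕ} (Ω : Set (E d)) (s : Set.Ioo (0 : ℝ) 1) : Variant → Type
  | .restricted => H0s Ω s
  | .extended => tildeHs Ω s
  | .spectral => SpectralHs Ω s

instance {d : ℕ} (Ω : Set (E d)) (s : Set.Ioo (0 : ℝ) 1) (k : Variant) :
    NormedAddCommGroup (W Ω s k) :=
  match k with
  | .restricted => inferInstanceAs (NormedAddCommGroup (H0s Ω s))
  | .extended => inferInstanceAs (NormedAddCommGroup (tildeHs Ω s))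
  | .spectral => inferInstanceAs (NormedAddCommGroup (SpectralHs Ω s))

instance {d : ℕ} (Ω : Set (E d)) (s : Set.Ioo (0 : ℝ) 1) (k : Variant) :
    InnerProductSpace ℝ (W Ω s k) :=
  match k with
  | .restricted => inferInstanceAs (InnerProductSpace ℝ (H0s Ω s))
  | .extended => inferInstanceAs (InnerProductSpace ℝ (tildeHs Ω s))
  | .spectral => inferInstanceAs (InnerProductSpace ℝ (SpectralHs Ω s))

/-- A representative of `w ∈ W`, a function that is determined almost everywhere on `Ω`. -/
def W.fn {d : ℕ} {Ω : Set (E d)} {s : Set.Ioo (0 : ℝ) 1} : {k : Variant} → W Ω s k → E d → ℝ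
  | .restricted => fun w => Hs.toL2 (Subtype.val (p := fun v => v ∈ H0s Ω s) w)
  | .extended => fun w => Hs.toL2 (Subtype.val (p := fun v => v ∈ tildeHs Ω s) w)
  | .spectral => fun w => SpectralHs.toL2 (Ω := Ω) (s := s) w

/-- `∫_Ω |w|^0 dx` with `0^0 = 0`, that is, the Lebesgue measure of `{x ∈ Ω : w(x) ≠ 0}`. -/
def W.l0 {d : ℕ} {Ω : Set (E d)} {s : Set.Ioo (0 : ℝ) 1} {k : Variant} (w : W Ω s k) : ℝ :=
  volume.real {x ∈ Ω | w.fn x ≠ 0}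

/-- The objective `F(w) + (α/2) ‖w‖_W² + β ∫_Ω |w|^0 dx`. -/
def objective {d : ℕ} {Ω : Set (E d)} {s : Set.Ioo (0 : ℝ) 1} {k : Variant}
    (F : W Ω s k → ℝ) (α β : ℝ) (w : W Ω s k) : ℝ :=
  F w + α / 2 * ‖w‖ ^ 2 + β * w.l0

/-- (Sequential) weak lower semicontinuity: if `u_n ⇀ u`, then `F(u) ≤ liminf F(u_n)`. -/
def WeaklyLSC {X : Type*} [NormedAddCommGroup X] [NormedSpace ℝ X] (F : X → ℝ) : Prop :=
  ∀ (u : ℕ → X) (x : X), (∀ l : StrongDual ℝ X, Tendsto (fun n => l (u n)) atTop (𝓝 (l x))) →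
    ∀ c < F x, ∀ᶠ n in atTop, c < F (u n)

/-- The assumptions on the smooth part `F` of the objective. -/
structure Admissible {X : Type*} [NormedAddCommGroup X] [NormedSpace ℝ X] (F : X → ℝ) : Prop where
  weaklyLSC : WeaklyLSC F
  bounded_below : ∃ (g : StrongDual ℝ X) (c : ℝ), ∀ w, g w + c ≤ F w
  contDiff : ContDiff ℝ 1 F

end FracSparse

end

namespace FracSparse

/-! Since `β ≠ 0`, the equation can be solved for the multiplier: it must be the functional `-β⁻¹
(F'(w₀) + α (w₀, ·))`, which settles existence and uniqueness without any minimality. Minimality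
enters only in the identity `⟨l₀, w₀⟩ = 0`.

In a general direction the measure of the support may jump, so the objective need not be
differentiable there. The ray `t ↦ t • w₀` is special: for `t ≠ 0` the functions `t • w₀` and `w₀`
have the same support up to a null set (`W.l0_smul`). Near `t = 1` the sparsity term is therefore
constant, and the smooth function `F(t w₀) + (α/2) t² ‖w₀‖²` has a local minimum at the interior
point `t = 1`. Its derivative `F'(w₀) w₀ + α ‖w₀‖²` vanishes (`fderiv_apply_self_of_isLocalMin`),
and inserting `v = w₀` into the equation gives the claim. The choice of inner product matters only
where scalar multiplication is traced back to `L²`. -/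

/-- The representative of `c • w` is almost everywhere in `Ω` the multiple by `c` of the one of
`w`. -/
theorem W.fn_smul_ae {d : ℕ} {Ω : Set (E d)} {s : Set.Ioo (0 : ℝ) 1} {k : Variant}
    (c : ℝ) (w : W Ω s k) : (c • w).fn =ᵐ[volume.restrict Ω] c • w.fn := by
  -- `W`, its module structure and `W.fn` are defined by matching on the variant. Once it is fixed,
  -- `c • w` unfolds to scalar multiplication in `L²`.
  cases k with
  | restricted =>
    exact Lp.coeFn_smul c (Hs.toL2 (Subtype.val (p := fun v => v ∈ H0s Ω s) w))
  | extended =>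
    -- Here the `L²` space is that of the whole space, so the identity is first obtained there and
    -- then restricted to `Ω`.
    exact ae_restrict_of_ae_restrict_of_subset (Set.subset_univ Ω)
      (Lp.coeFn_smul c (Hs.toL2 (Subtype.val (p := fun v => v ∈ tildeHs Ω s) w)))
  | spectral =>
    exact Lp.coeFn_smul c (SpectralHs.toL2 (Ω := Ω) (s := s) w)

/-- Multiplication by a nonzero constant does not change the measure of the support. -/
theorem W.l0_smul {d : ℕ} {Ω : Set (E d)} (hΩ : MeasurableSet Ω) {s : Set.Ioo (0 : ℝ) 1}
    {k : Variant} {c : ℝ} (hc : c ≠ 0) (w : W Ω s k) : (c • w).l0 = w.l0 := by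
  refine measureReal_congr (eventuallyEq_set.2 ?_)
  -- `W.l0` uses the unrestricted measure, so the identity on `Ω` is turned into an implication for
  -- almost every point of the whole space; this is where measurability of `Ω` is needed.
  filter_upwards [(ae_restrict_iff' hΩ).1 (W.fn_smul_ae c w)] with x hx
  refine and_congr_right fun hxΩ => ?_
  rw [hx hxΩ, Pi.smul_apply, smul_eq_mul, mul_ne_zero_iff_left hc]

/-- A local minimizer is stationary along its own ray, where the measure of the support is
constant near the minimizer. -/
theorem fderiv_apply_self_of_isLocalMin {d : ℕ} {Ω : Set (E d)} (hΩ : MeasurableSet Ω)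
    {s : Set.Ioo (0 : ℝ) 1} {k : Variant} {α β : ℝ} {F : W Ω s k → ℝ} {w₀ : W Ω s k}
    (hF : DifferentiableAt ℝ F w₀) (hw₀ : IsLocalMin (objective F α β) w₀) :
    fderiv ℝ F w₀ w₀ + α * inner ℝ w₀ w₀ = 0 := by
  have hray : HasDerivAt (fun t : ℝ => t • w₀) w₀ 1 := by
    simpa using (hasDerivAt_id (1 : ℝ)).smul_const w₀
  have hcomp : HasDerivAt (fun t : ℝ => F (t • w₀)) (fderiv ℝ F w₀ w₀) 1 := by
    -- The chain rule wants the base point in the form of the ray's value at `1`.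
    have hF' : HasFDerivAt F (fderiv ℝ F w₀) ((1 : ℝ) • w₀) := by
      simpa using hF.hasFDerivAt
    exact hF'.comp_hasDerivAt (1 : ℝ) hray
  have hsq : HasDerivAt (fun t : ℝ => α / 2 * (t ^ 2 * ‖w₀‖ ^ 2)) (α * inner ℝ w₀ w₀) 1 := by
    have h := ((hasDerivAt_pow 2 (1 : ℝ)).mul_const (‖w₀‖ ^ 2)).const_mul (α / 2)
    refine h.congr_deriv ?_
    rw [real_inner_self_eq_norm_sq]
    norm_num
    ring
  -- This is the objective along the ray without its sparsity term, which equals the constant `β *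
  -- w₀.l0` for `t ≠ 0` and so cancels from both sides of the inequality.
  have hmin : IsLocalMin (fun t : ℝ => F (t • w₀) + α / 2 * (t ^ 2 * ‖w₀‖ ^ 2)) 1 := by
    have hlim : Tendsto (fun t : ℝ => t • w₀) (𝓝 1) (𝓝 w₀) := by
      simpa using hray.continuousAt.tendsto
    filter_upwards [hlim.eventually hw₀, eventually_ne_nhds (one_ne_zero (α := ℝ))]
      with t ht ht0
    simp only [objective, W.l0_smul hΩ ht0, norm_smul, mul_pow, Real.norm_eq_abs, sq_abs] at ht
    simp only [one_smul, one_pow, one_mul]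
    linarith
  exact hmin.hasDerivAt_eq_zero (hcomp.add hsq)

end FracSparse

open FracSparse in
theorem mainTheorem7 {d : ℕ} (Ω : Set (E d)) (hΩ : IsBoundedLipschitzDomain Ω)
    (s : Set.Ioo (0 : ℝ) 1) (hs : (s : ℝ) ≠ 1 / 2) (k : Variant)
    (α β : ℝ) (hα : 0 < α) (hβ : 0 < β)
    (F : W Ω s k → ℝ) (hF : Admissible F)
    (w₀ : W Ω s k) (hw₀ : IsLocalMin (objective F α β) w₀) :
    (∃! l₀ : StrongDual ℝ (W Ω s k),
      ∀ v : W Ω s k, α * inner ℝ w₀ v + β * l₀ v = -(fderiv ℝ F w₀ v)) ∧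
    ∀ l₀ : StrongDual ℝ (W Ω s k),
      (∀ v : W Ω s k, α * inner ℝ w₀ v + β * l₀ v = -(fderiv ℝ F w₀ v)) → l₀ w₀ = 0 := by
  -- The witness is the equation solved for the multiplier, with `innerSL` supplying the continuity
  -- of `(w₀, ·)`.
  refine ⟨⟨-(β⁻¹ • (fderiv ℝ F w₀ + α • innerSL ℝ w₀)), fun v => ?_, fun l hl => ?_⟩,
    fun l hl => ?_⟩
  · simp only [neg_apply, FunLike.coe_smul, FunLike.coe_add, Pi.smul_apply, Pi.add_apply,
      innerSL_apply_apply, smul_eq_mul]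
    field_simp
    ring
  · ext v
    have h := hl v
    simp only [neg_apply, FunLike.coe_smul, FunLike.coe_add, Pi.smul_apply, Pi.add_apply,
      innerSL_apply_apply, smul_eq_mul]
    field_simp
    linarith
  -- With `v = w₀`, stationarity along the ray cancels all terms of the equation except `β * l w₀`.
  · have hstat := fderiv_apply_self_of_isLocalMin hΩ.isOpen.measurableSet
      (hF.contDiff.differentiable one_ne_zero w₀) hw₀
    have h : β * l w₀ = 0 := by linarith [hl w₀]
    exact (mul_eq_zero.1 h).resolve_left hβ.ne'
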